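/- Let $q$ be a complex number with $0<|q|<1$. Write $(a;p)_n=\prod_{i=0}^{n-1}(1-ap^i)$, $(a;p)_\infty=\prod_{i\ge 0}(1-ap^i)$, $(a_1,a_2,a_3;p)_\infty=(a_1;p)_\infty(a_2;p)_\infty(a_3;p)_\infty$, and $(q)_n=(q;q)_n$, $(q)_\infty=(q;q)_\infty$. **Theorem (Binomial extension of the Kurşungöz identities).** Let $j,r\ge 0$ and $k\ge 1$ be integers such that $j+r\le k$. Then $$\sum_{s_1\ge\cdots\ge s_k\ge 0} q^{s_1^2+\cdots+s_k^2+s_{k-r+1}+\cdots+s_{k-1}+2s_k}\cdot\frac{q^{-s_1-\cdots-s_j}(1+q^{s_1+s_2})(1+q^{s_2+s_3})\cdots(1+q^{s_{j-1}+s_j})}{(q)_{s_1-s_2}\cdots(q)_{s_{k-1}-s_k}(q^2;q^2)_{s_k}}$$ $$=\frac{1}{1+q}\sum_{s=0}^{j}\binom{j}{s}\left(\frac{(q^{2k+2},q^{k+2-r+j-2s},q^{k+r-j+2s};q^{2k+2})_\infty}{(q)_\infty}+q\,\frac{(q^{2k+2},q^{k-r+j-2s},q^{k+2+r-j+2s};q^{2k+2})_\infty}{(q)_\infty}\right),$$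 where the multisum converges absolutely. Here the linear part $s_{k-r+1}+\cdots+s_{k-1}+2s_k$ of the exponent means $\bigl(\sum_{i=k-r+1}^{k}s_i\bigr)+s_k$, so that it is $s_k$ when $r=0$; for $j\le 1$ the product $(1+q^{s_1+s_2})\cdots(1+q^{s_{j-1}+s_j})$ is empty. Moreover, the identity remains true, with the same right-hand side, if the $j$ factors $q^{-s_1}$ and $q^{-s_i}(1+q^{s_{i-1}+s_i})$, $2\le i\le j$, are replaced by the elements of any $j$-element subset of $$\{q^{-s_1}\}\cup\{q^{-s_i}(1+q^{s_{i-1}+s_i}) : 2\le i\le k-r\}.$$ -/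

import Mathlib

open Finset

noncomputable section

/-- The finite `q`-Pochhammer symbol `(a; p)_n = ∏_{i < n} (1 - a p^i)`. -/
def qPoch (a p : ℂ) (n : ℕ) : ℂ := ∏ i ∈ Finset.range n, (1 - a * p ^ i)

/-- The infinite `q`-Pochhammer symbol `(a; p)_∞ = ∏_{i ≥ 0} (1 - a p^i)`
(used only for `‖p‖ < 1`, where the product converges). -/
def qPochInf (a p : ℂ) : ℂ := ∏' i : ℕ, (1 - a * p ^ i)

/-- `(a, b, c; p)_∞ = (a; p)_∞ (b; p)_∞ (c; p)_∞`. -/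
def qPochInf₃ (a b c p : ℂ) : ℂ := qPochInf a p * qPochInf b p * qPochInf c p

/-- The summation range `s_1 ≥ s_2 ≥ ⋯ ≥ s_k ≥ 0`. -/
abbrev WeakDecr (k : ℕ) : Type := {s : Fin k → ℕ // Antitone s}

/-- The entry `s_i` with the index counted from `1`, for `1 ≤ i ≤ k`
(entries outside this range are `0` and do not occur below). -/
def WeakDecr.entry {k : ℕ} (s : WeakDecr k) (i : ℕ) : ℕ :=
  if h : 1 ≤ i ∧ i ≤ k then s.1 ⟨i - 1, by omega⟩ else 0

/-- The exponent `s_1² + ⋯ + s_k² + s_{k-r+1} + ⋯ + s_{k-1} + 2 s_k`, read as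
`(s_1² + ⋯ + s_k²) + (s_{k-r+1} + ⋯ + s_k) + s_k`; the middle sum is empty for `r = 0`. -/
def kurExponent {k : ℕ} (r : ℕ) (s : WeakDecr k) : ℕ :=
  (∑ i ∈ Finset.Icc 1 k, s.entry i ^ 2) + (∑ i ∈ Finset.Icc (k - r + 1) k, s.entry i) + s.entry k

/-- The denominator `(q)_{s_1 - s_2} ⋯ (q)_{s_{k-1} - s_k} (q²; q²)_{s_k}`. -/
def kurDenom {k : ℕ} (q : ℂ) (s : WeakDecr k) : ℂ :=
  (∏ i ∈ Finset.Icc 1 (k - 1), qPoch q q (s.entry i - s.entry (i + 1))) *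
    qPoch (q ^ 2) (q ^ 2) (s.entry k)

/-- The `i`-th allowed factor: `q^{-s_1}` for `i = 1`, and `q^{-s_i} (1 + q^{s_{i-1} + s_i})`
for `i ≥ 2`. -/
def kurFactor {k : ℕ} (q : ℂ) (s : WeakDecr k) (i : ℕ) : ℂ :=
  if i = 1 then q ^ (-(s.entry 1 : ℤ))
  else q ^ (-(s.entry i : ℤ)) * (1 + q ^ (s.entry (i - 1) + s.entry i))

/-- The product side
`1/(1+q) ∑_{s=0}^{j} C(j,s) ( (q^{2k+2}, q^{k+2-r+j-2s}, q^{k+r-j+2s}; q^{2k+2})_∞ / (q)_∞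
  + q (q^{2k+2}, q^{k-r+j-2s}, q^{k+2+r-j+2s}; q^{2k+2})_∞ / (q)_∞ )`,
with exponents computed in `ℤ`. -/
def kurProductSide (k r j : ℕ) (q : ℂ) : ℂ :=
  1 / (1 + q) * ∑ s ∈ Finset.range (j + 1), (j.choose s : ℂ) *
    (qPochInf₃ (q ^ (2 * k + 2)) (q ^ ((k : ℤ) + 2 - r + j - 2 * s))
        (q ^ ((k : ℤ) + r - j + 2 * s)) (q ^ (2 * k + 2)) / qPochInf q q
      + q * (qPochInf₃ (q ^ (2 * k + 2)) (q ^ ((k : ℤ) - r + j - 2 * s))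
        (q ^ ((k : ℤ) + 2 + r - j + 2 * s)) (q ^ (2 * k + 2)) / qPochInf q q))

end

open Filter Topology

/-! Put an extra entry L before s_1, with denominator (q)_{L-s_1} and, when 1 ∈ I, the factor
q^{-s_1}(1 + q^{L+s_1}). The truncated multisum then arises from q^s/(q²;q²)_s by k linear
operators, one per variable, and the Bailey kernels are eigenvectors of these operators. By
q-Chu–Vandermonde, the kernel relative to 1 has eigenvalue q^{n²} for a plain step
(`sum_baileyKernel`) and q^{n²}(q^n + q^{-n}) for a step carrying an allowed factor
(`sum_baileyKernel_twisted`); the kernel relative to q has eigenvalue q^{n²+n} for a step with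
linear term (`sum_baileyKernel'`). So only the number of allowed factors matters, not their
positions.

The seed is expanded in kernels relative to 1 (`hasSum_baileyPair`), passed to kernels relative to q
for the r inner steps, and brought back for the other k - r (`baileyKernel_sub_baileyKernel_succ`,
`hasSum_chainSum_kur`). As L → ∞ each kernel tends to 1/(q)_∞² and the extra denominator to (q)_∞,
which leaves a bilateral series divided by (q)_∞. Expanding (q^n + q^{-n})^j binomially turns that
series into theta functions, which the Jacobi triple product evaluates (`hasSum_kurCoeff`,
`hasSum_kurSummand`). -/

/-! ### Nonvanishing and convergence of q-Pochhammer symbols -/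

theorem one_sub_pow_succ_ne_zero {q : ℂ} (hq : ‖q‖ < 1) (m : ℕ) : 1 - q ^ (m + 1) ≠ 0 := by
  intro h
  have h1 : ‖q ^ (m + 1)‖ = 1 := by rw [← sub_eq_zero.1 h, norm_one]
  rw [norm_pow] at h1
  exact (pow_lt_one₀ (norm_nonneg q) hq m.succ_ne_zero).ne h1

theorem one_add_ne_zero_of_norm_lt_one {q : ℂ} (hq : ‖q‖ < 1) : 1 + q ≠ 0 := by
  intro h
  rw [eq_neg_of_add_eq_zero_right h, norm_neg, norm_one] at hq
  exact lt_irrefl _ hq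

theorem qPoch_succ (a p : ℂ) (n : ℕ) : qPoch a p (n + 1) = qPoch a p n * (1 - a * p ^ n) :=
  Finset.prod_range_succ _ _

theorem qPoch_self_ne_zero {q : ℂ} (hq : ‖q‖ < 1) (n : ℕ) : qPoch q q n ≠ 0 := by
  refine Finset.prod_ne_zero_iff.2 fun i _ => ?_
  rw [← pow_succ']
  exact one_sub_pow_succ_ne_zero hq i

theorem summable_qPoch_factor (a : ℂ) {p : ℂ} (hp : ‖p‖ < 1) :
    Summable fun i : ℕ => ‖-(a * p ^ i)‖ := by
  simp only [norm_neg, norm_mul, norm_pow]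
  exact (summable_geometric_of_lt_one (norm_nonneg p) hp).mul_left _

theorem tendsto_qPoch (a : ℂ) {p : ℂ} (hp : ‖p‖ < 1) :
    Tendsto (qPoch a p) atTop (𝓝 (qPochInf a p)) := by
  have h := (multipliable_one_add_of_summable (summable_qPoch_factor a hp)).hasProd.tendsto_prod_nat
  simp only [← sub_eq_add_neg] at h
  exact h

theorem qPochInf_self_ne_zero {q : ℂ} (hq : ‖q‖ < 1) : qPochInf q q ≠ 0 := by
  have h := tprod_one_add_ne_zero_of_summable (f := fun i : ℕ => -(q * q ^ i)) (fun i => by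
    rw [← sub_eq_add_neg, ← pow_succ']
    exact one_sub_pow_succ_ne_zero hq i) (summable_qPoch_factor q hq)
  simp only [← sub_eq_add_neg] at h
  exact h

theorem HasSum.of_eq {ι : Type*} {f g : ι → ℂ} {a b : ℂ} (h : HasSum f a) (hfg : ∀ i, g i = f i)
    (hab : b = a) : HasSum g b := by
  rw [hab, funext hfg]
  exact h

theorem HasSum.comp_int_sub {f : ℤ → ℂ} {a : ℂ} (h : HasSum f a) (c : ℤ) :
    HasSum (fun m => f (m - c)) a :=
  (Equiv.subRight c).hasSum_iff.2 h

theorem HasSum.comp_int_neg {f : ℤ → ℂ} {a : ℂ} (h : HasSum f a) : HasSum (fun m => f (-m)) a :=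
  (Equiv.neg ℤ).hasSum_iff.2 h

/-! ### Reciprocal q-factorials and Bailey kernels -/

/-- The reciprocal `1 / (q; q)_m`, extended by `0` to negative integers `m`. -/
noncomputable def invQFact (q : ℂ) (m : ℤ) : ℂ := if 0 ≤ m then (qPoch q q m.toNat)⁻¹ else 0

theorem invQFact_natCast (q : ℂ) (m : ℕ) : invQFact q m = (qPoch q q m)⁻¹ := by
  simp [invQFact]

theorem invQFact_of_neg (q : ℂ) {m : ℤ} (hm : m < 0) : invQFact q m = 0 :=
  if_neg hm.not_ge

theorem invQFact_zero (q : ℂ) : invQFact q 0 = 1 := by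
  simp [invQFact, qPoch]

/-- At m = 0 the factor 1 - q^0 vanishes, so the recurrence survives the extension by zero and no
boundary cases arise in the bilateral sums. -/
theorem invQFact_sub_one {q : ℂ} (hq : ‖q‖ < 1) (m : ℤ) :
    invQFact q (m - 1) = (1 - q ^ m) * invQFact q m := by
  rcases lt_or_ge m 0 with hm | hm
  · rw [invQFact_of_neg q hm, invQFact_of_neg q (by omega), mul_zero]
  lift m to ℕ using hm
  cases m with
  | zero => simp [invQFact_of_neg]
  | succ m =>
    have h1 := qPoch_self_ne_zero hq m
    have h2 := one_sub_pow_succ_ne_zero hq m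
    rw [show ((m + 1 : ℕ) : ℤ) - 1 = (m : ℕ) by push_cast; ring, invQFact_natCast,
      invQFact_natCast, qPoch_succ, ← pow_succ', zpow_natCast]
    field_simp

theorem exists_norm_invQFact_le {q : ℂ} (hq : ‖q‖ < 1) : ∃ C : ℝ, 1 ≤ C ∧ ∀ m, ‖invQFact q m‖ ≤ C := by
  have h := ((tendsto_qPoch q hq).inv₀ (qPochInf_self_ne_zero hq)).norm
  obtain ⟨C, hC⟩ := h.bddAbove_range
  have hC' : ∀ m : ℕ, ‖(qPoch q q m)⁻¹‖ ≤ C := fun m => hC ⟨m, rfl⟩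
  have h1 : 1 ≤ C := by simpa [qPoch] using hC' 0
  refine ⟨C, h1, fun m => ?_⟩
  unfold invQFact
  split_ifs
  · exact hC' _
  · rw [norm_zero]; linarith

theorem tendsto_invQFact {q : ℂ} (hq : ‖q‖ < 1) (n : ℤ) :
    Tendsto (fun L : ℕ => invQFact q (L + n)) atTop (𝓝 (qPochInf q q)⁻¹) := by
  have h := (tendsto_qPoch q hq).inv₀ (qPochInf_self_ne_zero hq)
  have h2 : Tendsto (fun L : ℕ => ((L : ℤ) + n).toNat) atTop atTop := by
    refine tendsto_atTop.2 fun b => ?_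
    filter_upwards [eventually_ge_atTop (b + n.natAbs)] with L hL
    omega
  refine (h.comp h2).congr' ?_
  filter_upwards [eventually_ge_atTop n.natAbs] with L hL
  simp only [invQFact, Function.comp]
  rw [if_pos (by omega)]

/-- The kernel `1 / ((q)_{L-n} (q)_{L+n})` of Bailey pairs relative to `1`. -/
noncomputable def baileyKernel (q : ℂ) (n L : ℤ) : ℂ := invQFact q (L - n) * invQFact q (L + n)

/-- The kernel `1 / ((q)_{L-n} (q)_{L+n+1})` of Bailey pairs relative to `q`. -/
noncomputable def baileyKernel' (q : ℂ) (n L : ℤ) : ℂ :=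
  invQFact q (L - n) * invQFact q (L + n + 1)

theorem baileyKernel_neg (q : ℂ) (n L : ℤ) : baileyKernel q (-n) L = baileyKernel q n L := by
  unfold baileyKernel
  rw [mul_comm, sub_neg_eq_add, ← sub_eq_add_neg]

theorem baileyKernel_eq_zero (q : ℂ) {n L : ℤ} (h : L < |n|) : baileyKernel q n L = 0 := by
  unfold baileyKernel
  rcases lt_abs.1 h with h | h
  · rw [invQFact_of_neg q (by omega), zero_mul]
  · rw [invQFact_of_neg q (m := L + n) (by omega), mul_zero]

theorem summable_mul_baileyKernel (q : ℂ) (c : ℤ → ℂ) (L : ℤ) :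
    Summable fun n => c n * baileyKernel q n L := by
  refine summable_of_hasFiniteSupport ((Set.finite_Icc (-L) L).subset fun n hn => ?_)
  by_contra h
  refine hn ?_
  simp only
  rw [baileyKernel_eq_zero q (by rw [Set.mem_Icc, ← abs_le] at h; omega), mul_zero]

/-- Dominated convergence: both factors of the kernel are bounded uniformly in n and L, and each
tends to 1/(q)_∞. -/
theorem tendsto_tsum_mul_baileyKernel {q : ℂ} (hq : ‖q‖ < 1) {c : ℤ → ℂ} (hc : Summable c) :
    Tendsto (fun L : ℕ => ∑' n, c n * baileyKernel q n L) atTop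
      (𝓝 ((∑' n, c n) * ((qPochInf q q)⁻¹ * (qPochInf q q)⁻¹))) := by
  obtain ⟨C, hC1, hC⟩ := exists_norm_invQFact_le hq
  rw [← tsum_mul_right]
  refine tendsto_tsum_of_dominated_convergence (bound := fun n => ‖c n‖ * (C * C))
    (hc.norm.mul_right _) (fun n => ?_) (Eventually.of_forall fun L n => ?_)
  · refine Tendsto.const_mul _ (Tendsto.mul ?_ (tendsto_invQFact hq n))
    simpa only [sub_eq_add_neg] using tendsto_invQFact hq (-n)
  · rw [norm_mul, baileyKernel, norm_mul]
    gcongr <;> exact hC _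

/-! ### The q-Chu–Vandermonde sums -/

/-- The `q`-Chu–Vandermonde sum over all integers. -/
theorem hasSum_qVandermonde {q : ℂ} (hq0 : q ≠ 0) (hq : ‖q‖ < 1) (N : ℕ) (a : ℤ) :
    HasSum (fun m : ℤ => q ^ (m ^ 2 + m * a) *
      (invQFact q (N - m) * invQFact q m * invQFact q (m + a)))
      (invQFact q N * invQFact q (N + a)) := by
  induction N generalizing a with
  | zero =>
    have h := hasSum_single (f := fun m : ℤ => q ^ (m ^ 2 + m * a) *
      (invQFact q ((0 : ℕ) - m) * invQFact q m * invQFact q (m + a))) 0 (fun m hm => by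
      rcases lt_or_gt_of_ne hm with h | h
      · simp [invQFact_of_neg q h]
      · rw [invQFact_of_neg q (m := (0 : ℕ) - m) (by simpa using h)]; simp)
    simpa [invQFact_zero] using h
  | succ N ih =>
    have h1 := one_sub_pow_succ_ne_zero hq N
    -- This realizes 1 - q^{N+1} = (1 - q^{N+1-m}) + q^{N+1-m}(1 - q^m): the first part lowers N -
    -- m, the second lowers m and, after a shift, is the sum with a + 1.
    have h2 := ((ih (a + 1)).comp_int_sub 1).mul_left (q ^ ((N : ℤ) + 1 + a))
    have h3 := ((ih a).add h2).mul_left (1 - q ^ (N + 1))⁻¹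
    refine h3.of_eq (fun m => ?_) ?_
    · rw [eq_inv_mul_iff_mul_eq₀ h1]
      have e1 := invQFact_sub_one hq ((N : ℤ) + 1 - m)
      have e2 := invQFact_sub_one hq m
      rw [show (N : ℤ) + 1 - m - 1 = N - m by ring] at e1
      push_cast
      rw [show (N : ℤ) - (m - 1) = N + 1 - m by ring, e1, e2,
        show m - 1 + (a + 1) = m + a by ring]
      have e3 : q ^ ((N : ℤ) + 1 + a) * q ^ ((m - 1) ^ 2 + (m - 1) * (a + 1)) =
          q ^ (m ^ 2 + m * a) * q ^ ((N : ℤ) + 1 - m) := by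
        rw [← zpow_add₀ hq0, ← zpow_add₀ hq0]; congr 1; ring
      have e4 : q ^ (N + 1) = q ^ ((N : ℤ) + 1 - m) * q ^ m := by
        rw [← zpow_add₀ hq0, ← zpow_natCast]; congr 1; push_cast; ring
      rw [e4]
      linear_combination (-(invQFact q ((N : ℤ) + 1 - m) * (1 - q ^ m) * invQFact q m *
        invQFact q (m + a))) * e3
    · rw [eq_inv_mul_iff_mul_eq₀ h1]
      have e1 := invQFact_sub_one hq ((N : ℤ) + 1)
      have e2 := invQFact_sub_one hq ((N : ℤ) + 1 + a)
      rw [show (N : ℤ) + 1 - 1 = N by ring] at e1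
      rw [show (N : ℤ) + 1 + a - 1 = N + a by ring] at e2
      have e4 : q ^ (N + 1) = q ^ ((N : ℤ) + 1) := by rw [← zpow_natCast]; push_cast; rfl
      push_cast
      rw [e4, e1, e2, show (N : ℤ) + (a + 1) = N + 1 + a by ring]
      ring

/-- The variant of the `q`-Chu–Vandermonde sum with the exponent lowered by `m`. -/
theorem hasSum_qVandermonde_sub {q : ℂ} (hq0 : q ≠ 0) (hq : ‖q‖ < 1) (N : ℕ) (a : ℤ) :
    HasSum (fun m : ℤ => q ^ (m ^ 2 + m * a - m) *
      (invQFact q (N - m) * invQFact q m * invQFact q (m + a)))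
      ((1 + q ^ a - q ^ (N + a)) * (invQFact q N * invQFact q (N + a))) := by
  -- Split 1 = (1 - q^{m+a}) + q^a q^m; the first part lowers a, the second restores the missing
  -- q^m.
  refine ((hasSum_qVandermonde hq0 hq N (a - 1)).add
    ((hasSum_qVandermonde hq0 hq N a).mul_left (q ^ a))).of_eq (fun m => ?_) ?_
  · have e := invQFact_sub_one hq (m + a)
    rw [show m + a - 1 = m + (a - 1) by ring] at e
    have e1 : q ^ (m ^ 2 + m * a) = q ^ (m ^ 2 + m * a - m) * q ^ m := by
      rw [← zpow_add₀ hq0]; congr 1; ring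
    rw [e, e1, zpow_add₀ hq0 m a, show m ^ 2 + m * (a - 1) = m ^ 2 + m * a - m by ring]
    ring
  · have e := invQFact_sub_one hq ((N : ℤ) + a)
    rw [show (N : ℤ) + a - 1 = N + (a - 1) by ring] at e
    rw [e]
    ring

/-! ### Bailey kernels as eigenvectors of the summation steps -/

theorem HasSum.sum_range_of_int {f : ℤ → ℂ} {a : ℂ} (h : HasSum f a) (L : ℕ)
    (hf : ∀ m : ℤ, m < 0 ∨ L < m → f m = 0) : ∑ s ∈ Finset.range (L + 1), f s = a := by
  have h2 := hasSum_sum_of_ne_finset_zero (L := .unconditional ℤ) (f := f) (s := (Finset.range (L + 1)).map Nat.castEmbedding)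
    (fun m hm => hf m (by
      by_contra hcon
      push Not at hcon
      obtain ⟨h0, h1⟩ := hcon
      lift m to ℕ using h0
      refine hm (Finset.mem_map.2 ⟨m, ?_, rfl⟩)
      rw [Finset.mem_range]
      omega))
  rw [Finset.sum_map] at h2
  exact h2.unique h

theorem baileyKernel_eq_zero_of_neg (q : ℂ) (n : ℤ) {m : ℤ} (hm : m < 0) :
    baileyKernel q n m = 0 :=
  baileyKernel_eq_zero q (hm.trans_le (abs_nonneg n))

theorem baileyKernel'_eq_zero_of_neg (q : ℂ) (n : ℤ) {m : ℤ} (hm : m < 0) :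
    baileyKernel' q n m = 0 := by
  unfold baileyKernel'
  rcases lt_or_ge n 0 with h | h
  · rw [invQFact_of_neg q (m := m + n + 1) (by omega), mul_zero]
  · rw [invQFact_of_neg q (by omega), zero_mul]

/-- The Bailey lemma step relative to `1`, with both parameters sent to infinity. -/
theorem sum_baileyKernel {q : ℂ} (hq0 : q ≠ 0) (hq : ‖q‖ < 1) (L : ℕ) (n : ℤ) :
    ∑ s ∈ Finset.range (L + 1), q ^ (s ^ 2) * invQFact q (L - s) * baileyKernel q n s =
      q ^ (n ^ 2) * baileyKernel q n L := by
  wlog hn : 0 ≤ n generalizing n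
  · have := this (-n) (by omega)
    simpa only [baileyKernel_neg, neg_sq] using this
  rcases lt_or_ge (L : ℤ) n with hLn | hLn
  · rw [baileyKernel_eq_zero q (by rwa [abs_of_nonneg hn]), mul_zero]
    refine Finset.sum_eq_zero fun s hs => ?_
    rw [Finset.mem_range] at hs
    rw [baileyKernel_eq_zero q (by rw [abs_of_nonneg hn]; omega), mul_zero]
  -- Vandermonde with s = n + m, N = L - n and a = 2n.
  obtain ⟨N, hN⟩ := Int.eq_ofNat_of_zero_le (sub_nonneg.2 hLn)
  have h := ((hasSum_qVandermonde hq0 hq N (2 * n)).comp_int_sub n).mul_left (q ^ (n ^ 2))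
  have h2 := h.of_eq (g := fun s : ℤ => q ^ (s ^ 2) * invQFact q (L - s) * baileyKernel q n s)
    (b := q ^ (n ^ 2) * baileyKernel q n L) (fun s => ?_) ?_
  · rw [← h2.sum_range_of_int L fun m hm => ?_]
    · refine Finset.sum_congr rfl fun s _ => ?_
      rw [← zpow_natCast]
      push_cast
      rfl
    · rcases hm with hm | hm
      · simp only [baileyKernel_eq_zero_of_neg q n hm, mul_zero]
      · rw [invQFact_of_neg q (by omega)]; simp
  · rw [← mul_assoc, ← zpow_add₀ hq0, ← hN, baileyKernel,
      show (L : ℤ) - n - (s - n) = L - s by ring, show s - n + 2 * n = s + n by ring,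
      show n ^ 2 + ((s - n) ^ 2 + (s - n) * (2 * n)) = s ^ 2 by ring]
    ring
  · rw [← hN, baileyKernel, show (L : ℤ) - n + 2 * n = L + n by ring]

/-- The Bailey lemma step relative to `1` with the factor `q^{-s} (1 + q^{L + s})` inserted. -/
theorem sum_baileyKernel_twisted {q : ℂ} (hq0 : q ≠ 0) (hq : ‖q‖ < 1) (L : ℕ) (n : ℤ) :
    ∑ s ∈ Finset.range (L + 1), q ^ (s ^ 2) * (q ^ (-(s : ℤ)) * (1 + q ^ (L + s))) *
      invQFact q (L - s) * baileyKernel q n s =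
      q ^ (n ^ 2) * (q ^ n + q ^ (-n)) * baileyKernel q n L := by
  wlog hn : 0 ≤ n generalizing n
  · have := this (-n) (by omega)
    rw [neg_neg, add_comm (q ^ (-n))] at this
    simpa only [baileyKernel_neg, neg_sq] using this
  rcases lt_or_ge (L : ℤ) n with hLn | hLn
  · rw [baileyKernel_eq_zero q (by rwa [abs_of_nonneg hn]), mul_zero]
    refine Finset.sum_eq_zero fun s hs => ?_
    rw [Finset.mem_range] at hs
    rw [baileyKernel_eq_zero q (by rw [abs_of_nonneg hn]; omega), mul_zero]
  obtain ⟨N, hN⟩ := Int.eq_ofNat_of_zero_le (sub_nonneg.2 hLn)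
  -- The inserted factor is q^{-s} + q^L. Its first term yields q^n + q^{-n} - q^L, and the plain
  -- step, multiplied by q^L, cancels the defect.
  have h := ((hasSum_qVandermonde_sub hq0 hq N (2 * n)).comp_int_sub n).mul_left (q ^ (n ^ 2 - n))
  have h2 := h.of_eq (g := fun s : ℤ => q ^ (s ^ 2 - s) * invQFact q (L - s) * baileyKernel q n s)
    (b := q ^ (n ^ 2) * (q ^ n + q ^ (-n) - q ^ (L : ℤ)) * baileyKernel q n L)
    (fun s => ?_) ?_
  · have h3 := h2.sum_range_of_int L fun m hm => ?_
    · rw [show q ^ (n ^ 2) * (q ^ n + q ^ (-n)) * baileyKernel q n L =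
        q ^ (n ^ 2) * (q ^ n + q ^ (-n) - q ^ (L : ℤ)) * baileyKernel q n L +
        q ^ (L : ℤ) * (q ^ (n ^ 2) * baileyKernel q n L) by ring, ← h3,
        ← sum_baileyKernel hq0 hq, Finset.mul_sum, ← Finset.sum_add_distrib]
      refine Finset.sum_congr rfl fun s _ => ?_
      rw [zpow_sub₀ hq0, pow_add, ← zpow_natCast q (s ^ 2), zpow_natCast q L,
        zpow_neg, zpow_natCast q s]
      push_cast
      have : q ^ s ≠ 0 := pow_ne_zero _ hq0
      field_simp
    · rcases hm with hm | hm
      · simp only [baileyKernel_eq_zero_of_neg q n hm, mul_zero]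
      · rw [invQFact_of_neg q (by omega)]; simp
  · rw [← mul_assoc, ← zpow_add₀ hq0, ← hN, baileyKernel,
      show (L : ℤ) - n - (s - n) = L - s by ring, show s - n + 2 * n = s + n by ring,
      show n ^ 2 - n + ((s - n) ^ 2 + (s - n) * (2 * n) - (s - n)) = s ^ 2 - s by ring]
    ring
  · rw [← hN, baileyKernel, show (L : ℤ) - n + 2 * n = L + n by ring, ← mul_assoc (q ^ (n ^ 2 - n))]
    refine congrArg (· * _) ?_
    have hx : q ^ n ≠ 0 := zpow_ne_zero _ hq0
    rw [zpow_sub₀ hq0, two_mul, zpow_add₀ hq0 n n, zpow_add₀ hq0 _ n, zpow_neg]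
    field_simp
    ring

/-- The Bailey lemma step relative to `q`, with both parameters sent to infinity. -/
theorem sum_baileyKernel' {q : ℂ} (hq0 : q ≠ 0) (hq : ‖q‖ < 1) (L : ℕ) (n : ℤ) :
    ∑ s ∈ Finset.range (L + 1), q ^ (s ^ 2) * q ^ s * invQFact q (L - s) * baileyKernel' q n s =
      q ^ (n ^ 2 + n) * baileyKernel' q n L := by
  -- The reflection n ↦ -n - 1 reduces the claim to n ≥ 0.
  have hsymm : ∀ n m : ℤ, baileyKernel' q (-n - 1) m = baileyKernel' q n m := fun n m => by
    unfold baileyKernel'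
    rw [mul_comm, show m - (-n - 1) = m + n + 1 by ring, show m + (-n - 1) + 1 = m - n by ring]
  wlog hn : 0 ≤ n generalizing n
  · have := this (-n - 1) (by omega)
    simpa only [hsymm, show (-n - 1) ^ 2 + (-n - 1) = n ^ 2 + n by ring] using this
  have hzero : ∀ m : ℤ, m < n → baileyKernel' q n m = 0 := fun m hm => by
    rw [baileyKernel', invQFact_of_neg q (by omega), zero_mul]
  rcases lt_or_ge (L : ℤ) n with hLn | hLn
  · rw [hzero _ hLn, mul_zero]
    refine Finset.sum_eq_zero fun s hs => ?_
    rw [Finset.mem_range] at hs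
    rw [hzero _ (by omega), mul_zero]
  obtain ⟨N, hN⟩ := Int.eq_ofNat_of_zero_le (sub_nonneg.2 hLn)
  have h := ((hasSum_qVandermonde hq0 hq N (2 * n + 1)).comp_int_sub n).mul_left (q ^ (n ^ 2 + n))
  have h2 := h.of_eq (g := fun s : ℤ => q ^ (s ^ 2 + s) * invQFact q (L - s) * baileyKernel' q n s)
    (b := q ^ (n ^ 2 + n) * baileyKernel' q n L) (fun s => ?_) ?_
  · rw [← h2.sum_range_of_int L fun m hm => ?_]
    · refine Finset.sum_congr rfl fun s _ => ?_
      rw [← pow_add, ← zpow_natCast]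
      push_cast
      rfl
    · rcases hm with hm | hm
      · simp only [baileyKernel'_eq_zero_of_neg q n hm, mul_zero]
      · rw [invQFact_of_neg q (by omega)]; simp
  · rw [← mul_assoc, ← zpow_add₀ hq0, ← hN, baileyKernel',
      show (L : ℤ) - n - (s - n) = L - s by ring, show s - n + (2 * n + 1) = s + n + 1 by ring,
      show n ^ 2 + n + ((s - n) ^ 2 + (s - n) * (2 * n + 1)) = s ^ 2 + s by ring]
    ring
  · rw [← hN, baileyKernel', show (L : ℤ) - n + (2 * n + 1) = L + n + 1 by ring]

/-! ### Change of kernel and the initial Bailey pair -/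

/-- Over the common denominator (q)_{L-n}(q)_{L+n+1} the numerators are 1 - q^{L+n+1} and q^{2n+1}(1
- q^{L-n}). Used in both directions, to pass between expansions relative to 1 and relative to q. -/
theorem baileyKernel_sub_baileyKernel_succ {q : ℂ} (hq0 : q ≠ 0) (hq : ‖q‖ < 1) (n L : ℤ) :
    (1 - q ^ (2 * n + 1)) * baileyKernel' q n L =
      baileyKernel q n L - q ^ (2 * n + 1) * baileyKernel q (n + 1) L := by
  have e1 := invQFact_sub_one hq (L - n)
  have e2 := invQFact_sub_one hq (L + n + 1)
  rw [add_sub_cancel_right] at e2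
  rw [baileyKernel, baileyKernel, baileyKernel', e2, ← sub_sub, e1, ← add_assoc,
    show q ^ (L + n + 1) = q ^ (2 * n + 1) * q ^ (L - n) by rw [← zpow_add₀ hq0]; congr 1; ring]
  ring

/-- The Bailey pair relative to `1` with `β_L = q^L / (q²; q²)_L`. -/
theorem hasSum_baileyPair {q : ℂ} (hq0 : q ≠ 0) (hq : ‖q‖ < 1) (L : ℕ) :
    HasSum (fun n : ℤ => (-1) ^ n * q ^ (n ^ 2 - n) * baileyKernel q n L)
      (q ^ L / qPoch (q ^ 2) (q ^ 2) L) := by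
  induction L with
  | zero =>
    have h := hasSum_single (f := fun n : ℤ => (-1) ^ n * q ^ (n ^ 2 - n) *
      baileyKernel q n (0 : ℕ)) 0 (fun m hm => by
        rw [baileyKernel_eq_zero q (by simpa using hm), mul_zero])
    simpa [baileyKernel, invQFact_zero, qPoch] using h
  | succ L ih =>
    have hne : 1 - q ^ (2 * (L + 1)) ≠ 0 := one_sub_pow_succ_ne_zero hq (2 * L + 1)
    -- Certificate for (1 - q^{2(L+1)}) β_{L+1} = q β_L: termwise the two sides differ by `A`, which
    -- is odd in n and sums to zero, and by the telescoping difference R(n+1) - R(n).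
    set A : ℤ → ℂ := fun n => (-1) ^ n * q ^ (n ^ 2) *
      (((1 - q) / 2 - (1 + q) * q ^ (2 * (L + 1))) * (q ^ n - q ^ (-n)) +
        q * q ^ (L + 1) * (q ^ (2 * n) - q ^ (-(2 * n)))) * baileyKernel q n (L + 1) with hA
    set R : ℤ → ℂ := fun n => (-1) ^ n * q ^ (n ^ 2) * (((q - 1) / 2) * q ^ (-n) - q ^ (L + 1)) *
      (1 - q ^ (L + 1) * q ^ n) * baileyKernel q n (L + 1) with hR
    have sA : Summable A := summable_mul_baileyKernel q _ _
    have sR : Summable R := summable_mul_baileyKernel q _ _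
    have hA0 : ∑' n, A n = 0 := by
      have h1 := sA.hasSum.comp_int_neg
      have h2 := sA.hasSum.neg.of_eq (g := fun n => A (-n)) (fun n => by
        simp only [hA]
        rw [baileyKernel_neg, neg_sq, neg_neg, mul_neg, neg_neg, zpow_neg, ← inv_zpow,
          show (-1 : ℂ)⁻¹ = -1 by norm_num]
        ring) rfl
      exact self_eq_neg.1 (h1.unique h2)
    have h := (((ih.mul_left q).sub sA.hasSum).add ((sR.hasSum.comp_int_sub (-1)).sub
      sR.hasSum)).mul_left (1 - q ^ (2 * (L + 1)))⁻¹
    refine h.of_eq (fun n => ?_) ?_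
    · rw [eq_inv_mul_iff_mul_eq₀ hne]
      simp only [hA, hR]
      have e1 := invQFact_sub_one hq ((L : ℤ) + 1 - n)
      have e2 := invQFact_sub_one hq ((L : ℤ) + 1 + n)
      have e3 := invQFact_sub_one hq ((L : ℤ) + 1 + n + 1)
      rw [show (L : ℤ) + 1 - n - 1 = L - n by ring] at e1
      rw [show (L : ℤ) + 1 + n - 1 = L + n by ring] at e2
      rw [show (L : ℤ) + 1 + n + 1 - 1 = L + 1 + n by ring] at e3
      -- The factor 1 - q^{L+1+n} in `R` is there for this relation, which expresses R(n+1) through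
      -- the kernel at n without division.
      have hk1 : (1 - q ^ (L + 1) * q ^ (n + 1)) * baileyKernel q (n + 1) (L + 1) =
          (1 - q ^ (L + 1) * q ^ (-n)) * baileyKernel q n (L + 1) := by
        rw [baileyKernel, baileyKernel, show (L : ℤ) + 1 - (n + 1) = L - n by ring, ← add_assoc,
          e1, e3, sub_eq_add_neg (_ + 1) n, zpow_add₀ hq0 _ (-n), add_assoc ((L : ℤ) + 1) n 1,
          zpow_add₀ hq0 _ (n + 1), ← zpow_natCast q (L + 1)]
        push_cast
        ring
      have hk0 : baileyKernel q n L = (1 - q ^ (L + 1) * q ^ (-n)) * (1 - q ^ (L + 1) * q ^ n) *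
          baileyKernel q n (L + 1) := by
        rw [baileyKernel, baileyKernel, e1, e2, sub_eq_add_neg _ n, zpow_add₀ hq0 _ (-n),
          zpow_add₀ hq0 _ n, ← zpow_natCast q (L + 1)]
        push_cast
        ring
      rw [sub_neg_eq_add, hk0, mul_assoc _ _ (baileyKernel q (n + 1) (L + 1)), hk1]
      have hx : q ^ n ≠ 0 := zpow_ne_zero _ hq0
      rw [show (n + 1) ^ 2 = n ^ 2 + (n + n) + 1 by ring, zpow_add_one₀ (by norm_num : (-1 : ℂ) ≠ 0),
        zpow_add_one₀ hq0, zpow_add₀ hq0 _ (n + n), zpow_add₀ hq0 n n, zpow_sub₀ hq0, zpow_neg,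
        zpow_neg, zpow_neg, two_mul n, zpow_add₀ hq0 n n, zpow_add_one₀ hq0]
      push_cast
      field_simp
      ring
    · rw [eq_inv_mul_iff_mul_eq₀ hne, hA0, qPoch_succ, sub_self, add_zero, sub_zero,
        ← pow_mul, ← pow_add, show 2 + 2 * L = 2 * (L + 1) by ring, pow_succ q L]
      field_simp

/-! ### The Jacobi triple product -/

/-- The finite Jacobi triple product. -/
theorem hasSum_finite_tripleProduct {t z : ℂ} (ht0 : t ≠ 0) (ht : ‖t ^ 2‖ < 1) (hz : z ≠ 0) (N : ℕ) :
    HasSum (fun n : ℤ => ((-1) ^ n * z ^ n * t ^ (n ^ 2 - n)) * baileyKernel (t ^ 2) n N)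
      (qPoch z (t ^ 2) N * qPoch (t ^ 2 / z) (t ^ 2) N / qPoch (t ^ 2) (t ^ 2) (2 * N)) := by
  -- Taking t as a square root of the base writes p^{n(n-1)/2} as t^{n²-n}, without halves.
  set p := t ^ 2 with hp
  have hp0 : p ≠ 0 := pow_ne_zero _ ht0
  induction N with
  | zero =>
    have h := hasSum_single (f := fun n : ℤ => ((-1) ^ n * z ^ n * t ^ (n ^ 2 - n)) *
      baileyKernel p n (0 : ℕ)) 0 (fun m hm => by
        rw [baileyKernel_eq_zero p (by simpa using hm), mul_zero])
    simpa [baileyKernel, invQFact_zero, qPoch] using h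
  | succ N ih =>
    have h1 : 1 - p * p ^ (2 * N) ≠ 0 := by
      rw [← pow_succ']; exact one_sub_pow_succ_ne_zero ht _
    have h2 : 1 - p * p ^ (2 * N + 1) ≠ 0 := by
      rw [← pow_succ']; exact one_sub_pow_succ_ne_zero ht _
    have h3 := qPoch_self_ne_zero ht (2 * N)
    -- Expansion of the new factors (1 - z p^N)(1 - p^{N+1}/z); index shifts absorb z and 1/z.
    have h := (((ih.mul_left (1 + p * p ^ (2 * N))).sub ((ih.comp_int_sub 1).mul_left
      (z * p ^ N))).sub ((ih.comp_int_sub (-1)).mul_left (p ^ (N + 1) / z))).mul_left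
      ((1 - p * p ^ (2 * N)) * (1 - p * p ^ (2 * N + 1)))⁻¹
    refine h.of_eq (fun n => ?_) ?_
    · rw [eq_inv_mul_iff_mul_eq₀ (mul_ne_zero h1 h2)]
      have e1 := invQFact_sub_one ht ((N : ℤ) + 1 - n)
      have e2 := invQFact_sub_one ht ((N : ℤ) + 1 + n)
      have e3 := invQFact_sub_one ht ((N : ℤ) - n)
      have e4 := invQFact_sub_one ht ((N : ℤ) + n)
      rw [show (N : ℤ) + 1 - n - 1 = N - n by ring] at e1
      rw [show (N : ℤ) + 1 + n - 1 = N + n by ring] at e2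
      have hx : t ^ n ≠ 0 := zpow_ne_zero _ ht0
      have hxp : p ^ n = t ^ n * t ^ n := by rw [hp, ← zpow_natCast, ← zpow_mul, ← zpow_add₀ ht0]; congr 1; push_cast; ring
      have f1 : p ^ ((N : ℤ) + 1 - n) = p * p ^ N / (t ^ n * t ^ n) := by
        rw [zpow_sub₀ hp0, zpow_add_one₀ hp0, zpow_natCast, hxp]; ring
      have f2 : p ^ ((N : ℤ) + 1 + n) = p * p ^ N * (t ^ n * t ^ n) := by
        rw [zpow_add₀ hp0, zpow_add_one₀ hp0, zpow_natCast, hxp]; ring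
      have f3 : p ^ ((N : ℤ) - n) = p ^ N / (t ^ n * t ^ n) := by
        rw [zpow_sub₀ hp0, zpow_natCast, hxp]
      have f4 : p ^ ((N : ℤ) + n) = p ^ N * (t ^ n * t ^ n) := by
        rw [zpow_add₀ hp0, zpow_natCast, hxp]
      rw [f1] at e1
      rw [f2] at e2
      rw [f3] at e3
      rw [f4] at e4
      have k0 : baileyKernel p n N = (1 - p * p ^ N / (t ^ n * t ^ n)) *
          (1 - p * p ^ N * (t ^ n * t ^ n)) * baileyKernel p n (N + 1 : ℕ) := by
        rw [baileyKernel, baileyKernel, e1, e2]; push_cast; ring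
      have k1 : baileyKernel p (n - 1) N = (1 - p ^ N * (t ^ n * t ^ n)) *
          (1 - p * p ^ N * (t ^ n * t ^ n)) * baileyKernel p n (N + 1 : ℕ) := by
        rw [baileyKernel, baileyKernel, ← add_sub_assoc, e4, e2,
          show (N : ℤ) - (n - 1) = N + 1 - n by ring]; push_cast; ring
      have k2 : baileyKernel p (n - -1) N = (1 - p ^ N / (t ^ n * t ^ n)) *
          (1 - p * p ^ N / (t ^ n * t ^ n)) * baileyKernel p n (N + 1 : ℕ) := by
        rw [baileyKernel, baileyKernel, show (N : ℤ) - (n - -1) = N - n - 1 by ring, e3, e1,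
          show (N : ℤ) + (n - -1) = N + 1 + n by ring]; push_cast; ring
      have m1 : t ^ ((n - 1) ^ 2 - (n - 1)) = t ^ (n ^ 2 - n) / (t ^ n * t ^ n) * p := by
        rw [hp, ← zpow_natCast t 2, ← zpow_add₀ ht0 n n, ← zpow_sub₀ ht0, ← zpow_add₀ ht0]
        congr 1; push_cast; ring
      have m2 : t ^ ((n - -1) ^ 2 - (n - -1)) = t ^ (n ^ 2 - n) * (t ^ n * t ^ n) := by
        rw [← zpow_add₀ ht0 n n, ← zpow_add₀ ht0]
        congr 1; ring
      have hm : (-1 : ℂ) ≠ 0 := by norm_num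
      rw [k0, k1, k2, m1, m2, sub_neg_eq_add, zpow_add_one₀ hm, zpow_add_one₀ hz, zpow_sub_one₀ hm,
        zpow_sub_one₀ hz, show (-1 : ℂ)⁻¹ = -1 by norm_num]
      field_simp
      ring
    · rw [eq_inv_mul_iff_mul_eq₀ (mul_ne_zero h1 h2), show 2 * (N + 1) = 2 * N + 1 + 1 by ring,
        qPoch_succ, qPoch_succ, qPoch_succ, qPoch_succ]
      field_simp
      ring

/-- The Jacobi triple product identity. -/
theorem hasSum_tripleProduct {t z : ℂ} (ht0 : t ≠ 0) (ht : ‖t ^ 2‖ < 1) (hz : z ≠ 0)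
    (hs : Summable fun n : ℤ => (-1) ^ n * z ^ n * t ^ (n ^ 2 - n)) :
    HasSum (fun n : ℤ => (-1) ^ n * z ^ n * t ^ (n ^ 2 - n))
      (qPochInf₃ (t ^ 2) z (t ^ 2 / z) (t ^ 2)) := by
  have h1 := tendsto_tsum_mul_baileyKernel ht hs
  have h2 := (((tendsto_qPoch z ht).mul (tendsto_qPoch (t ^ 2 / z) ht))).div
    ((tendsto_qPoch (t ^ 2) ht).comp (tendsto_id.const_mul_atTop' (two_pos : 0 < 2)))
    (qPochInf_self_ne_zero ht)
  have h3 := tendsto_nhds_unique (h1.congr fun N =>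
    (hasSum_finite_tripleProduct ht0 ht hz N).tsum_eq) h2
  have h0 := qPochInf_self_ne_zero ht
  convert hs.hasSum using 1
  unfold qPochInf₃
  field_simp at h3
  rw [h3]

theorem summable_zpow_quadratic {q : ℂ} (hq0 : q ≠ 0) (hq : ‖q‖ < 1) {K : ℕ} (hK : 1 ≤ K) (b : ℤ) :
    Summable fun n : ℤ => (-1) ^ n * q ^ (K * n ^ 2 + b * n) := by
  have hρ : 0 < ‖q‖ := norm_pos_iff.2 hq0
  have h0 : Summable fun n : ℤ => ‖q‖ ^ n.natAbs := by
    refine Summable.of_nat_of_neg ?_ ?_ <;> simpa using summable_geometric_of_lt_one hρ.le hq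
  -- The comparison rests on K n² + b n ≥ |n| - (|b| + 1)².
  refine Summable.of_norm_bounded (h0.mul_left (‖q‖ ^ (-(|b| + 1) ^ 2))) fun n => ?_
  rw [norm_mul, norm_zpow, norm_neg, norm_one, one_zpow, one_mul, norm_zpow, ← zpow_natCast,
    ← zpow_add₀ hρ.ne']
  refine zpow_le_zpow_right_of_le_one₀ hρ hq.le ?_
  rw [Int.natCast_natAbs]
  have e1 : (1 : ℤ) ≤ K := by exact_mod_cast hK
  have e2 : |n| ^ 2 = n ^ 2 := sq_abs n
  have e3 : -(|b| * |n|) ≤ b * n := by rw [← abs_mul]; exact neg_abs_le _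
  nlinarith [sq_nonneg (|n| - (|b| + 1)), sq_nonneg n, abs_nonneg n, abs_nonneg b,
    mul_nonneg (abs_nonneg n) (abs_nonneg b), mul_nonneg (sub_nonneg.2 e1) (sq_nonneg n)]

/-- The triple product in base `q^{2K}`. -/
theorem hasSum_theta {q : ℂ} (hq0 : q ≠ 0) (hq : ‖q‖ < 1) {K : ℕ} (hK : 1 ≤ K) (b : ℤ) :
    HasSum (fun n : ℤ => (-1) ^ n * q ^ (K * n ^ 2 + b * n))
      (qPochInf₃ (q ^ (2 * K)) (q ^ (K + b)) (q ^ (K - b)) (q ^ (2 * K))) := by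
  have hs := summable_zpow_quadratic hq0 hq hK b
  -- Since K n² + b n = (K + b) n + K (n² - n), take z = q^{K+b} and t = q^K.
  have hterm : ∀ n : ℤ, (-1) ^ n * q ^ (K * n ^ 2 + b * n) =
      (-1) ^ n * (q ^ (K + b)) ^ n * (q ^ K) ^ (n ^ 2 - n) := fun n => by
    rw [mul_assoc, ← zpow_natCast q K, ← zpow_mul, ← zpow_mul, ← zpow_add₀ hq0]
    congr 2
    ring
  have hnorm : ‖(q ^ K) ^ 2‖ < 1 := by
    rw [← pow_mul, norm_pow]
    exact pow_lt_one₀ (norm_nonneg q) hq (by omega)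
  have h := hasSum_tripleProduct (pow_ne_zero K hq0) hnorm (zpow_ne_zero (K + b) hq0)
    (hs.congr fun n => by rw [hterm n])
  have e1 : (q ^ K) ^ 2 = q ^ (2 * K) := by rw [← pow_mul, mul_comm]
  have e2 : q ^ (2 * K) / q ^ ((K : ℤ) + b) = q ^ ((K : ℤ) - b) := by
    rw [← zpow_natCast, ← zpow_sub₀ hq0]
    congr 1
    push_cast
    ring
  rw [e1, e2] at h
  exact h.of_eq hterm rfl

/-! ### Sums over decreasing chains -/

theorem summable_prod_pi {b : ℕ → ℝ} (hb0 : ∀ s, 0 ≤ b s) (hb : Summable b) (t : ℕ) :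
    Summable fun s : Fin t → ℕ => ∏ i, b (s i) := by
  induction t with
  | zero => exact (hasSum_fintype _).summable
  | succ t ih =>
    rw [← (Fin.consEquiv fun _ : Fin (t + 1) => ℕ).summable_iff]
    refine (hb.mul_of_nonneg ih hb0 fun s => Finset.prod_nonneg fun i _ => hb0 _).congr fun x => ?_
    simp [Fin.consEquiv, Fin.prod_univ_succ]

/-- The weight of a chain `L, s 0, …, s (t - 1)`; the step `w i` is used when `i + 1` entries of
the chain remain, and the last entry is weighted by `g`. -/
def chainTerm (w : ℕ → ℕ → ℕ → ℂ) (g : ℕ → ℂ) : (t : ℕ) → ℕ → (Fin t → ℕ) → ℂ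
  | 0, L, _ => g L
  | t + 1, L, s => w t L (s 0) * chainTerm w g t (s 0) (Fin.tail s)

/-- The sum of the weights of all weakly decreasing chains of length `t` below `L`. -/
def chainSum (w : ℕ → ℕ → ℕ → ℂ) (g : ℕ → ℂ) : ℕ → ℕ → ℂ
  | 0, L => g L
  | t + 1, L => ∑ s ∈ Finset.range (L + 1), w t L s * chainSum w g t s

section Chain

variable {w : ℕ → ℕ → ℕ → ℂ} {g : ℕ → ℂ} {b : ℕ → ℝ} {C : ℝ}

theorem norm_chainTerm_le (hw : ∀ t L s, ‖w t L s‖ ≤ b s) (hg : ∀ s, ‖g s‖ ≤ C) (t L : ℕ)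
    (s : Fin t → ℕ) : ‖chainTerm w g t L s‖ ≤ (∏ i, b (s i)) * C := by
  induction t generalizing L with
  | zero => simpa [chainTerm] using hg L
  | succ t ih =>
    rw [chainTerm, norm_mul, Fin.prod_univ_succ, mul_assoc]
    exact mul_le_mul (hw _ _ _) (ih _ _) (norm_nonneg _) ((norm_nonneg _).trans (hw 0 0 _))

theorem summable_chainTerm (hb : Summable b) (hw : ∀ t L s, ‖w t L s‖ ≤ b s)
    (hg : ∀ s, ‖g s‖ ≤ C) (t L : ℕ) : Summable (chainTerm w g t L) :=
  .of_norm_bounded ((summable_prod_pi (fun s => (norm_nonneg _).trans (hw 0 0 s)) hb t).mul_right C)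
    (norm_chainTerm_le hw hg t L)

/-- Absolute summability allows summing entry by entry; since a step vanishes for s > L, each
iterated sum is finite. -/
theorem hasSum_chainTerm (hb : Summable b) (hw : ∀ t L s, ‖w t L s‖ ≤ b s) (hg : ∀ s, ‖g s‖ ≤ C)
    (hsupp : ∀ t L s, L < s → w t L s = 0) (t L : ℕ) :
    HasSum (chainTerm w g t L) (chainSum w g t L) := by
  induction t generalizing L with
  | zero => exact hasSum_unique _
  | succ t ih =>
    have h := (summable_chainTerm hb hw hg (t + 1) L).hasSum
    have h1 := (Fin.consEquiv fun _ : Fin (t + 1) => ℕ).hasSum_iff.2 h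
    have h2 : HasSum (fun s => w t L s * chainSum w g t s) _ :=
      h1.prod_fiberwise fun s => (ih s).mul_left (w t L s)
    have h3 := hasSum_sum_of_ne_finset_zero (L := .unconditional ℕ)
      (f := fun s => w t L s * chainSum w g t s) (s := Finset.range (L + 1)) fun s hs => by
        rw [Finset.mem_range] at hs
        rw [hsupp t L s (by omega), zero_mul]
    rw [h2.unique h3] at h
    exact h

/-- The entries of the chain `L, s 0, …, s (t - 1), 0, 0, …`. -/
def chainEntry {t : ℕ} (L : ℕ) (s : Fin t → ℕ) : ℕ → ℕ
  | 0 => L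
  | i + 1 => if h : i < t then s ⟨i, h⟩ else 0

theorem chainEntry_tail {t : ℕ} (L : ℕ) (s : Fin (t + 1) → ℕ) (i : ℕ) :
    chainEntry (s 0) (Fin.tail s) i = chainEntry L s (i + 1) := by
  cases i with
  | zero => simp [chainEntry]
  | succ i => simp [chainEntry, Fin.tail]

theorem chainTerm_eq_prod (w : ℕ → ℕ → ℕ → ℂ) (g : ℕ → ℂ) (t L : ℕ) (s : Fin t → ℕ) :
    chainTerm w g t L s =
      (∏ i ∈ Finset.range t, w (t - 1 - i) (chainEntry L s i) (chainEntry L s (i + 1))) *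
        g (chainEntry L s t) := by
  induction t generalizing L with
  | zero => simp [chainTerm, chainEntry]
  | succ t ih =>
    rw [chainTerm, ih, Finset.prod_range_succ']
    simp only [chainEntry_tail L s]
    rw [show chainEntry L s (0 + 1) = s 0 by simp [chainEntry]]
    simp only [Nat.add_sub_cancel, Nat.sub_zero, show ∀ i, t - 1 - i = t - (i + 1) by omega,
      show chainEntry L s 0 = L from rfl]
    ring

end Chain

/-- One step of a chain sum applied to a bilateral expansion whose kernel is an eigenvector. -/
theorem hasSum_chainSum_succ {w : ℕ → ℕ → ℕ → ℂ} {g : ℕ → ℂ} {t : ℕ} {a ev : ℤ → ℂ}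
    {u : ℤ → ℕ → ℂ} (h : ∀ L, HasSum (fun n => a n * u n L) (chainSum w g t L))
    (hu : ∀ n L, ∑ s ∈ Finset.range (L + 1), w t L s * u n s = ev n * u n L) (L : ℕ) :
    HasSum (fun n => a n * ev n * u n L) (chainSum w g (t + 1) L) := by
  refine (hasSum_sum fun s (_ : s ∈ Finset.range (L + 1)) => (h s).mul_left (w t L s)).of_eq
    (fun n => ?_) rfl
  rw [mul_assoc, ← hu, Finset.mul_sum]
  exact Finset.sum_congr rfl fun s _ => by ring

/-! ### Bilateral expansion of the truncated multisum -/

/-- The part of the `i`-th summand of the Kurşungöz multisum that depends on `s_{i-1} = L` and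
`s_i = s`, apart from the denominators. -/
noncomputable def kurNumer (q : ℂ) (k r : ℕ) (I : Finset ℕ) (i L s : ℕ) : ℂ :=
  q ^ (s ^ 2) * (if k - r + 1 ≤ i then q ^ s else 1) *
    (if i ∈ I then q ^ (-(s : ℤ)) * (1 + q ^ (L + s)) else 1)

/-- The steps of the Kurşungöz multisum, indexed by the number of remaining variables. -/
noncomputable def kurStep (q : ℂ) (k r : ℕ) (I : Finset ℕ) (t L s : ℕ) : ℂ :=
  kurNumer q k r I (k - t) L s * invQFact q ((L : ℤ) - s)

/-- The innermost factor `q^s / (q²; q²)_s`. -/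
noncomputable def kurLast (q : ℂ) (s : ℕ) : ℂ := q ^ s / qPoch (q ^ 2) (q ^ 2) s

section Kur

variable {q : ℂ} {k r : ℕ} {I : Finset ℕ}

theorem hasSum_chainSum_inner (hq0 : q ≠ 0) (hq : ‖q‖ < 1) (hr : r ≤ k)
    (hI : I ⊆ Finset.Icc 1 (k - r)) (t : ℕ) (ht : t ≤ r)
    (L : ℕ) :
    HasSum (fun n : ℤ => (-1) ^ n * q ^ (n ^ 2 - n) / (1 + q) * (q ^ (n ^ 2 + n)) ^ t *
      ((1 - q ^ (2 * n + 1)) * baileyKernel' q n L))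
      (chainSum (kurStep q k r I) (kurLast q) t L) := by
  induction t generalizing L with
  | zero =>
    -- With α_n = (-1)^n q^{n²-n} one has q α_{n+1} = -q^{2n+1} α_n, so adding q times the shifted
    -- series produces the kernel relative to q. The value is multiplied by 1 + q, whence the
    -- prefactor 1/(1 + q).
    have h := (hasSum_baileyPair hq0 hq L).mul_left (1 / (1 + q))
    have h1 := one_add_ne_zero_of_norm_lt_one hq
    refine (h.add ((h.comp_int_sub (-1)).mul_left q)).of_eq (fun n => ?_) ?_
    · rw [baileyKernel_sub_baileyKernel_succ hq0 hq, sub_neg_eq_add,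
        zpow_add_one₀ (by norm_num : (-1 : ℂ) ≠ 0),
        show (n + 1) ^ 2 - (n + 1) = (n ^ 2 - n) + 2 * n by ring, zpow_add₀ hq0 _ (2 * n),
        zpow_add_one₀ hq0]
      ring
    · rw [chainSum, kurLast]
      field_simp
  | succ t ih =>
    refine (hasSum_chainSum_succ (u := fun n L => (1 - q ^ (2 * n + 1)) * baileyKernel' q n L)
      (ih (by omega)) (ev := fun n => q ^ (n ^ 2 + n)) (fun n L => ?_) L).of_eq
      (fun n => by ring) rfl
    have hnot : k - t ∉ I := fun h => by
      have := Finset.mem_Icc.1 (hI h)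
      omega
    rw [mul_left_comm, ← sum_baileyKernel' hq0 hq, Finset.mul_sum]
    refine Finset.sum_congr rfl fun s _ => ?_
    rw [kurStep, kurNumer, if_neg hnot, if_pos (by omega)]
    ring

/-- The coefficients of the expansion of the inner part of the multisum relative to `1`. -/
noncomputable def kurCoeff (q : ℂ) (r : ℕ) (n : ℤ) : ℂ :=
  (-1) ^ n / (1 + q) * (q ^ ((r + 1) * n ^ 2 + (r - 1) * n) +
    q * q ^ ((r + 1) * n ^ 2 - (r + 1) * n))

theorem hasSum_chainSum_kurCoeff (hq0 : q ≠ 0) (hq : ‖q‖ < 1) (hr : r ≤ k)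
    (hI : I ⊆ Finset.Icc 1 (k - r)) (L : ℕ) :
    HasSum (fun n : ℤ => kurCoeff q r n * baileyKernel q n L)
      (chainSum (kurStep q k r I) (kurLast q) r L) := by
  set e : ℤ → ℂ := fun n => (-1) ^ n * q ^ (n ^ 2 - n) / (1 + q) * (q ^ (n ^ 2 + n)) ^ r
  have h := hasSum_chainSum_inner hq0 hq hr hI r le_rfl L
  have s1 := summable_mul_baileyKernel q e L
  have s2 := summable_mul_baileyKernel q (fun n => e (n - 1) * q ^ (2 * n - 1)) L
  -- Return to kernels relative to 1: split each kernel difference and shift the second half by one.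
  have hval := h.unique ((s1.hasSum.sub (s2.hasSum.comp_int_sub (-1))).of_eq (fun n => ?_) rfl)
  · refine (s1.hasSum.sub s2.hasSum).of_eq (fun n => ?_) hval
    rw [← sub_mul]
    congr 1
    simp only [kurCoeff, e]
    rw [zpow_sub_one₀ (by norm_num : (-1 : ℂ) ≠ 0), ← zpow_natCast _ r, ← zpow_natCast _ r,
      ← zpow_mul, ← zpow_mul,
      show ((r : ℤ) + 1) * n ^ 2 + (r - 1) * n = (n ^ 2 - n) + (n ^ 2 + n) * r by ring,
      show ((r : ℤ) + 1) * n ^ 2 - (r + 1) * n = ((n - 1) ^ 2 - (n - 1)) +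
        ((n - 1) ^ 2 + (n - 1)) * r + (2 * n - 1) + (-1) by ring,
      zpow_add₀ hq0 _ (-1), zpow_add₀ hq0 _ (2 * n - 1), zpow_add₀ hq0 (n ^ 2 - n),
      zpow_add₀ hq0 ((n - 1) ^ 2 - (n - 1)), zpow_neg_one]
    field_simp
    ring
  · rw [baileyKernel_sub_baileyKernel_succ hq0 hq, sub_neg_eq_add, add_sub_cancel_right,
      show 2 * (n + 1) - 1 = 2 * n + 1 by ring]
    ring

/-- Each further step multiplies the n-th coefficient by its eigenvalue, twisted exactly when the
index of the step lies in `I`. -/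
theorem hasSum_chainSum_outer (hq0 : q ≠ 0) (hq : ‖q‖ < 1) (hr : r ≤ k)
    (hI : I ⊆ Finset.Icc 1 (k - r)) (t : ℕ) (ht : t ≤ k - r) (L : ℕ) :
    HasSum (fun n : ℤ => kurCoeff q r n * (∏ i ∈ Finset.range t,
      (q ^ (n ^ 2) * if k - r - i ∈ I then q ^ n + q ^ (-n) else 1)) * baileyKernel q n L)
      (chainSum (kurStep q k r I) (kurLast q) (r + t) L) := by
  induction t generalizing L with
  | zero => simpa using hasSum_chainSum_kurCoeff hq0 hq hr hI L
  | succ t ih =>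
    refine (hasSum_chainSum_succ (u := fun n L => baileyKernel q n L) (ih (by omega))
      (ev := fun n => q ^ (n ^ 2) * if k - r - t ∈ I then q ^ n + q ^ (-n) else 1)
      (fun n L => ?_) L).of_eq (fun n => ?_) rfl
    · simp only [kurStep, kurNumer, ← Nat.sub_sub, if_neg (show ¬k - r + 1 ≤ k - r - t by omega)]
      split_ifs with hi
      · rw [← sum_baileyKernel_twisted hq0 hq]
        exact Finset.sum_congr rfl fun s _ => by ring
      · rw [mul_one, ← sum_baileyKernel hq0 hq]
        exact Finset.sum_congr rfl fun s _ => by ring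
    · rw [Finset.prod_range_succ]
      ring

theorem hasSum_chainSum_kur (hq0 : q ≠ 0) (hq : ‖q‖ < 1) (hr : r ≤ k)
    (hI : I ⊆ Finset.Icc 1 (k - r)) (L : ℕ) :
    HasSum (fun n : ℤ => kurCoeff q r n * q ^ (((k : ℤ) - r) * n ^ 2) * (q ^ n + q ^ (-n)) ^ I.card *
      baileyKernel q n L) (chainSum (kurStep q k r I) (kurLast q) k L) := by
  have h := hasSum_chainSum_outer hq0 hq hr hI (k - r) le_rfl L
  rw [Nat.add_sub_cancel' hr] at h
  refine h.of_eq (fun n => ?_) rfl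
  have e1 : ∏ i ∈ Finset.range (k - r), (if k - r - i ∈ I then q ^ n + q ^ (-n) else 1) =
      (q ^ n + q ^ (-n)) ^ I.card := by
    rw [← Finset.prod_range_reflect]
    have : ∀ i ∈ Finset.range (k - r), (if k - r - (k - r - 1 - i) ∈ I then q ^ n + q ^ (-n) else 1) =
        (if 1 + i ∈ I then q ^ n + q ^ (-n) else 1) := fun i hi => by
      rw [Finset.mem_range] at hi
      rw [show k - r - (k - r - 1 - i) = 1 + i by omega]
    rw [Finset.prod_congr rfl this, Finset.range_eq_Ico,
      Finset.prod_Ico_add (fun i => if i ∈ I then q ^ n + q ^ (-n) else 1), zero_add,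
      Finset.prod_ite_mem, Finset.inter_eq_right.2 ?_, Finset.prod_const]
    intro i hi
    have := Finset.mem_Icc.1 (hI hi)
    rw [Finset.mem_Ico]
    omega
  rw [Finset.prod_mul_distrib, e1, Finset.prod_const, Finset.card_range, ← zpow_natCast _ (k - r),
    ← zpow_mul, Nat.cast_sub hr, mul_comm ((k : ℤ) - r)]
  ring

/-- The bilateral series of the product side. -/
theorem hasSum_kurCoeff (hq0 : q ≠ 0) (hq : ‖q‖ < 1) (k r j : ℕ) :
    HasSum (fun n : ℤ => kurCoeff q r n * q ^ (((k : ℤ) - r) * n ^ 2) * (q ^ n + q ^ (-n)) ^ j)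
      (kurProductSide k r j q * qPochInf q q) := by
  have hth := fun s : ℕ =>
    ((hasSum_theta hq0 hq (K := k + 1) (by omega) ((r : ℤ) - 1 - j + 2 * s)).add
      ((hasSum_theta hq0 hq (K := k + 1) (by omega) (-(r : ℤ) - 1 + j - 2 * s)).mul_left q)).mul_left
      (j.choose s : ℂ)
  have h := (hasSum_sum fun s (_ : s ∈ Finset.range (j + 1)) => hth s).mul_left (1 / (1 + q))
  refine h.of_eq (fun n => ?_) ?_
  · have hb1 : (q ^ n + q ^ (-n)) ^ j = ∑ s ∈ Finset.range (j + 1),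
        (j.choose s : ℂ) * q ^ ((2 * (s : ℤ) - j) * n) := by
      rw [add_pow]
      refine Finset.sum_congr rfl fun s hs => ?_
      rw [Finset.mem_range] at hs
      rw [← zpow_natCast _ s, ← zpow_natCast _ (j - s), ← zpow_mul, ← zpow_mul, ← zpow_add₀ hq0,
        mul_comm, Nat.cast_sub (by omega)]
      congr 2
      ring
    -- The same binomial expansion in reversed order, because s enters the second theta exponent
    -- with the opposite sign.
    have hb2 : (q ^ n + q ^ (-n)) ^ j = ∑ s ∈ Finset.range (j + 1),
        (j.choose s : ℂ) * q ^ (((j : ℤ) - 2 * s) * n) := by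
      rw [add_comm, add_pow]
      refine Finset.sum_congr rfl fun s hs => ?_
      rw [Finset.mem_range] at hs
      rw [← zpow_natCast _ s, ← zpow_natCast _ (j - s), ← zpow_mul, ← zpow_mul, ← zpow_add₀ hq0,
        mul_comm, Nat.cast_sub (by omega)]
      congr 2
      ring
    simp only [mul_add (Nat.cast _ : ℂ), Finset.sum_add_distrib]
    have e1 : ∑ s ∈ Finset.range (j + 1), (j.choose s : ℂ) * ((-1) ^ n *
        q ^ (((k + 1 : ℕ) : ℤ) * n ^ 2 + ((r : ℤ) - 1 - j + 2 * s) * n)) =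
        (-1) ^ n * q ^ ((k + 1) * n ^ 2 + (r - 1) * n) * (q ^ n + q ^ (-n)) ^ j := by
      rw [hb1, Finset.mul_sum]
      refine Finset.sum_congr rfl fun s _ => ?_
      rw [show ((k + 1 : ℕ) : ℤ) * n ^ 2 + ((r : ℤ) - 1 - j + 2 * s) * n =
        ((k + 1) * n ^ 2 + (r - 1) * n) + (2 * (s : ℤ) - j) * n by push_cast; ring, zpow_add₀ hq0]
      ring
    have e2 : ∑ s ∈ Finset.range (j + 1), (j.choose s : ℂ) * (q * ((-1) ^ n *
        q ^ (((k + 1 : ℕ) : ℤ) * n ^ 2 + (-(r : ℤ) - 1 + j - 2 * s) * n))) =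
        q * (-1) ^ n * q ^ ((k + 1) * n ^ 2 - (r + 1) * n) * (q ^ n + q ^ (-n)) ^ j := by
      rw [hb2, Finset.mul_sum]
      refine Finset.sum_congr rfl fun s _ => ?_
      rw [show ((k + 1 : ℕ) : ℤ) * n ^ 2 + (-(r : ℤ) - 1 + j - 2 * s) * n =
        ((k + 1) * n ^ 2 - (r + 1) * n) + ((j : ℤ) - 2 * s) * n by push_cast; ring, zpow_add₀ hq0]
      ring
    rw [e1, e2, kurCoeff,
      show ((k : ℤ) + 1) * n ^ 2 + (r - 1) * n = ((r + 1) * n ^ 2 + (r - 1) * n) + (k - r) * n ^ 2 by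
        ring,
      show ((k : ℤ) + 1) * n ^ 2 - (r + 1) * n = ((r + 1) * n ^ 2 - (r + 1) * n) + (k - r) * n ^ 2 by
        ring, zpow_add₀ hq0 _ (((k : ℤ) - r) * n ^ 2), zpow_add₀ hq0 _ (((k : ℤ) - r) * n ^ 2)]
    ring
  · rw [kurProductSide, mul_assoc, Finset.sum_mul]
    refine congrArg _ (Finset.sum_congr rfl fun s _ => ?_)
    have h0 := qPochInf_self_ne_zero hq
    rw [show 2 * (k + 1) = 2 * k + 2 by ring]
    push_cast
    rw [show (k : ℤ) + 1 + (r - 1 - j + 2 * s) = k + r - j + 2 * s by ring,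
      show (k : ℤ) + 1 - (r - 1 - j + 2 * s) = k + 2 - r + j - 2 * s by ring,
      show (k : ℤ) + 1 + (-r - 1 + j - 2 * s) = k - r + j - 2 * s by ring,
      show (k : ℤ) + 1 - (-r - 1 + j - 2 * s) = k + 2 + r - j + 2 * s by ring]
    unfold qPochInf₃
    field_simp

end Kur

/-! ### Passage to the limit and identification of the multisum -/

section Kur

variable {q : ℂ} {k r : ℕ} {I : Finset ℕ}

/-- The part of the summand of the multisum that depends on `s_1` alone. -/
noncomputable def kurHead (q : ℂ) (k r : ℕ) (I : Finset ℕ) (s : ℕ) : ℂ :=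
  q ^ (s ^ 2) * (if k - r + 1 ≤ 1 then q ^ s else 1) * (if 1 ∈ I then q ^ (-(s : ℤ)) else 1)

/-- The summand of the multisum over `s_1, …, s_{k + 1}`, extended by zero to all tuples. -/
noncomputable def kurSummand (q : ℂ) (k r : ℕ) (I : Finset ℕ) (s : Fin (k + 1) → ℕ) : ℂ :=
  kurHead q (k + 1) r I (s 0) *
    chainTerm (kurStep q (k + 1) r I) (kurLast q) k (s 0) (Fin.tail s)

theorem summable_norm_pow_sq (hq0 : q ≠ 0) (hq : ‖q‖ < 1) :
    Summable fun s : ℕ => ‖q‖ ^ (s ^ 2) * (‖q‖ ^ s)⁻¹ := by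
  have hρ : 0 < ‖q‖ := norm_pos_iff.2 hq0
  refine Summable.of_nonneg_of_le (fun s => by positivity) (fun s => ?_)
    ((summable_geometric_of_lt_one hρ.le hq).mul_right ‖q‖⁻¹)
  rw [← zpow_natCast, ← zpow_natCast, ← zpow_neg, ← zpow_add₀ hρ.ne', ← zpow_sub_one₀ hρ.ne']
  refine zpow_le_zpow_right_of_le_one₀ hρ hq.le ?_
  push_cast
  nlinarith [sq_nonneg ((s : ℤ) - 1)]

theorem norm_factor_le (hq0 : q ≠ 0) (hq : ‖q‖ < 1) (s : ℕ) {B : ℂ} (hB : ‖B‖ ≤ (‖q‖ ^ s)⁻¹ * 2)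
    (P : Prop) [Decidable P] :
    ‖q ^ (s ^ 2) * (if P then q ^ s else 1) * B‖ ≤ 2 * (‖q‖ ^ (s ^ 2) * (‖q‖ ^ s)⁻¹) := by
  have h1 : ‖(if P then q ^ s else 1 : ℂ)‖ ≤ 1 := by
    split_ifs
    · rw [norm_pow]; exact pow_le_one₀ (norm_nonneg q) hq.le
    · simp
  calc ‖q ^ (s ^ 2) * (if P then q ^ s else 1) * B‖ ≤ ‖q‖ ^ (s ^ 2) * 1 * ((‖q‖ ^ s)⁻¹ * 2) := by
        rw [norm_mul, norm_mul, norm_pow]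
        gcongr
    _ = _ := by ring

theorem one_le_inv_norm_pow (hq0 : q ≠ 0) (hq : ‖q‖ < 1) (s : ℕ) : 1 ≤ (‖q‖ ^ s)⁻¹ :=
  (one_le_inv₀ (pow_pos (norm_pos_iff.2 hq0) s)).2 (pow_le_one₀ (norm_nonneg q) hq.le)

theorem norm_one_add_pow_le (hq : ‖q‖ < 1) (s : ℕ) : ‖1 + q ^ s‖ ≤ 2 := by
  refine (norm_add_le _ _).trans ?_
  rw [norm_one, norm_pow]
  linarith [pow_le_one₀ (n := s) (norm_nonneg q) hq.le]

theorem norm_kurHead_le (hq0 : q ≠ 0) (hq : ‖q‖ < 1) (k r : ℕ) (I : Finset ℕ) (s : ℕ) :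
    ‖kurHead q k r I s‖ ≤ 2 * (‖q‖ ^ (s ^ 2) * (‖q‖ ^ s)⁻¹) := by
  refine norm_factor_le hq0 hq s ?_ _
  have := one_le_inv_norm_pow hq0 hq s
  split_ifs
  · rw [norm_zpow, zpow_neg, zpow_natCast]; linarith
  · rw [norm_one]; linarith

theorem norm_kurNumer_le (hq0 : q ≠ 0) (hq : ‖q‖ < 1) (k r : ℕ) (I : Finset ℕ) (i L s : ℕ) :
    ‖kurNumer q k r I i L s‖ ≤ 2 * (‖q‖ ^ (s ^ 2) * (‖q‖ ^ s)⁻¹) := by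
  refine norm_factor_le hq0 hq s ?_ _
  have := one_le_inv_norm_pow hq0 hq s
  split_ifs
  · rw [norm_mul, norm_zpow, zpow_neg, zpow_natCast]
    exact mul_le_mul_of_nonneg_left (norm_one_add_pow_le hq _) (by linarith)
  · rw [norm_one]; linarith

theorem exists_norm_kurLast_le (hq : ‖q‖ < 1) : ∃ C : ℝ, ∀ s, ‖kurLast q s‖ ≤ C := by
  have hq2 : ‖q ^ 2‖ < 1 := by
    rw [norm_pow]; exact pow_lt_one₀ (norm_nonneg q) hq two_ne_zero
  obtain ⟨C, hC1, hC⟩ := exists_norm_invQFact_le hq2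
  refine ⟨C, fun s => ?_⟩
  have h := hC s
  rw [invQFact_natCast] at h
  rw [kurLast, div_eq_mul_inv, norm_mul, norm_pow]
  exact (mul_le_of_le_one_left (norm_nonneg _) (pow_le_one₀ (norm_nonneg q) hq.le)).trans h

theorem norm_kurStep_le (hq0 : q ≠ 0) (hq : ‖q‖ < 1) {C : ℝ} (hC : ∀ m, ‖invQFact q m‖ ≤ C)
    (k r : ℕ) (I : Finset ℕ) (t L s : ℕ) :
    ‖kurStep q k r I t L s‖ ≤ 2 * (‖q‖ ^ (s ^ 2) * (‖q‖ ^ s)⁻¹) * C := by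
  rw [kurStep, norm_mul]
  exact mul_le_mul (norm_kurNumer_le hq0 hq _ _ _ _ _ _) (hC _) (norm_nonneg _) (by positivity)

theorem summable_norm_kurSummand (hq0 : q ≠ 0) (hq : ‖q‖ < 1) (k r : ℕ) (I : Finset ℕ) :
    Summable fun s => ‖kurSummand q k r I s‖ := by
  obtain ⟨C, -, hC⟩ := exists_norm_invQFact_le hq
  obtain ⟨D, hD⟩ := exists_norm_kurLast_le hq
  have hb := (summable_norm_pow_sq hq0 hq).mul_left 2
  have hw := norm_kurStep_le hq0 hq hC (k + 1) r I
  rw [← (Fin.consEquiv fun _ : Fin (k + 1) => ℕ).summable_iff]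
  refine Summable.of_nonneg_of_le (fun _ => norm_nonneg _) (fun x => ?_)
    (hb.mul_of_nonneg ((summable_prod_pi (fun s => (norm_nonneg _).trans (hw 0 0 s))
      (hb.mul_right C) k).mul_right D) (fun s => by positivity) fun s => ?_)
  · simp only [Function.comp, kurSummand, Fin.consEquiv, Equiv.coe_fn_mk, Fin.cons_zero,
      Fin.tail_cons, norm_mul]
    exact mul_le_mul (norm_kurHead_le hq0 hq _ _ _ _) (norm_chainTerm_le hw hD _ _ _)
      (norm_nonneg _) (by positivity)
  · exact (norm_nonneg _).trans (norm_chainTerm_le hw hD k 0 s)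

/-- Isolates the dependence on L: the last two factors tend to 1 and 1/(q)_∞ and are uniformly
bounded, so the summand itself provides the dominating series. -/
theorem chainTerm_kurStep_eq (k r L : ℕ) (s : Fin (k + 1) → ℕ) :
    chainTerm (kurStep q (k + 1) r I) (kurLast q) (k + 1) L s =
      kurSummand q k r I s *
        ((if 1 ∈ I then 1 + q ^ (L + s 0) else 1) * invQFact q ((L : ℤ) - s 0)) := by
  rw [chainTerm, kurSummand, kurStep, kurNumer, kurHead, Nat.add_sub_cancel_left]
  split_ifs <;> ring

theorem hasSum_kurSummand (hq0 : q ≠ 0) (hq : ‖q‖ < 1) (hr : r ≤ k + 1)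
    (hI : I ⊆ Finset.Icc 1 (k + 1 - r)) :
    HasSum (kurSummand q k r I) (kurProductSide (k + 1) r I.card q) := by
  obtain ⟨C, -, hC⟩ := exists_norm_invQFact_le hq
  obtain ⟨D, hD⟩ := exists_norm_kurLast_le hq
  have hsum := summable_norm_kurSummand hq0 hq k r I
  have h1 : Tendsto (fun L => ∑' s, chainTerm (kurStep q (k + 1) r I) (kurLast q) (k + 1) L s) atTop
      (𝓝 (∑' s, kurSummand q k r I s * (1 * (qPochInf q q)⁻¹))) := by
    refine tendsto_tsum_of_dominated_convergence (hsum.mul_right (2 * C)) (fun s => ?_)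
      (Eventually.of_forall fun L s => ?_)
    · simp only [chainTerm_kurStep_eq]
      refine Tendsto.const_mul _ (Tendsto.mul ?_ ?_)
      · split_ifs
        · have := (tendsto_pow_atTop_nhds_zero_of_norm_lt_one hq).comp (tendsto_add_atTop_nat (s 0))
          simpa using this.const_add 1
        · exact tendsto_const_nhds
      · simpa only [sub_eq_add_neg] using tendsto_invQFact hq (-(s 0 : ℤ))
    · rw [chainTerm_kurStep_eq, norm_mul, norm_mul]
      refine mul_le_mul_of_nonneg_left (mul_le_mul ?_ (hC _) (norm_nonneg _) two_pos.le)
        (norm_nonneg _)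
      split_ifs
      · exact norm_one_add_pow_le hq _
      · rw [norm_one]; exact one_le_two
  have h2 := hasSum_kurCoeff hq0 hq (k + 1) r I.card
  have h3 := tendsto_tsum_mul_baileyKernel hq h2.summable
  have hsupp : ∀ t L s, L < s → kurStep q (k + 1) r I t L s = 0 := fun t L s h => by
    rw [kurStep, invQFact_of_neg q (by omega), mul_zero]
  -- Two limits of the same truncated multisum: termwise over chains, and through its bilateral
  -- expansion. One factor 1/(q)_∞ cancels.
  have h4 := tendsto_nhds_unique h1 (h3.congr fun L => by
    rw [(hasSum_chainTerm (((summable_norm_pow_sq hq0 hq).mul_left 2).mul_right C)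
      (norm_kurStep_le hq0 hq hC (k + 1) r I) hD hsupp (k + 1) L).tsum_eq,
      (hasSum_chainSum_kur hq0 hq hr hI L).tsum_eq])
  rw [tsum_mul_right, h2.tsum_eq] at h4
  have h0 := qPochInf_self_ne_zero hq
  have h5 := hsum.of_norm.hasSum
  have h6 : ∑' s, kurSummand q k r I s = kurProductSide (k + 1) r I.card q := by
    field_simp at h4
    exact h4
  rwa [h6] at h5

theorem prod_Icc_one_eq_prod_range (f : ℕ → ℂ) (n : ℕ) :
    ∏ i ∈ Finset.Icc 1 n, f i = ∏ i ∈ Finset.range n, f (i + 1) := by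
  induction n with
  | zero => simp
  | succ n ih => rw [Finset.prod_Icc_succ_top (by omega), Finset.prod_range_succ, ih]

theorem WeakDecr.entry_succ_le {k : ℕ} (s : WeakDecr k) {i : ℕ} (hi : 1 ≤ i) :
    s.entry (i + 1) ≤ s.entry i := by
  unfold WeakDecr.entry
  split_ifs with h1 h2
  · exact s.2 (by rw [Fin.mk_le_mk]; omega)
  · omega
  · exact Nat.zero_le _
  · exact le_rfl

theorem kurSummand_eq_prod (hI : I ⊆ Finset.Icc 1 (k + 1)) (s : WeakDecr (k + 1)) :
    kurSummand q k r I s.1 =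
      q ^ kurExponent r s * ((∏ i ∈ I, kurFactor q s i) / kurDenom q s) := by
  set F : ℕ → ℂ := fun i => q ^ (s.entry i ^ 2) *
    (if k + 1 - r + 1 ≤ i then q ^ s.entry i else 1) * (if i ∈ I then kurFactor q s i else 1) with hF
  -- The leading 0 is a dummy: only entries from s_1 on are read.
  have hentry : ∀ i, chainEntry 0 s.1 (i + 1) = s.entry (i + 1) := fun i => by
    simp [chainEntry, WeakDecr.entry]
  have hhead : kurHead q (k + 1) r I (s.1 0) = F 1 := by
    rw [show s.1 0 = s.entry 1 by simp [WeakDecr.entry]]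
    simp only [kurHead, hF, kurFactor, if_true]
  have hstep : ∀ i ∈ Finset.range k, kurStep q (k + 1) r I (k - 1 - i) (s.entry (i + 1))
      (s.entry (i + 1 + 1)) = F (i + 1 + 1) *
        (qPoch q q (s.entry (i + 1) - s.entry (i + 1 + 1)))⁻¹ := fun i hi => by
    rw [Finset.mem_range] at hi
    rw [kurStep, kurNumer, show k + 1 - (k - 1 - i) = i + 1 + 1 by omega,
      ← Nat.cast_sub (s.entry_succ_le (by omega)), invQFact_natCast]
    simp only [hF, kurFactor]
    rw [if_neg (by omega : ¬i + 1 + 1 = 1), Nat.add_sub_cancel]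
  have hprod : ∏ i ∈ Finset.Icc 1 (k + 1), F i = q ^ (∑ i ∈ Finset.Icc 1 (k + 1), s.entry i ^ 2) *
      q ^ (∑ i ∈ Finset.Icc (k + 1 - r + 1) (k + 1), s.entry i) * ∏ i ∈ I, kurFactor q s i := by
    simp only [hF]
    rw [Finset.prod_mul_distrib, Finset.prod_mul_distrib, Finset.prod_pow_eq_pow_sum,
      Finset.prod_ite_mem, Finset.inter_eq_right.2 hI, ← Finset.prod_filter,
      Finset.prod_pow_eq_pow_sum]
    congr 4
    ext i
    rw [Finset.mem_filter, Finset.mem_Icc, Finset.mem_Icc]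
    omega
  rw [kurSummand, chainTerm_eq_prod, hhead]
  simp only [chainEntry_tail 0, hentry]
  rw [Finset.prod_congr rfl hstep, Finset.prod_mul_distrib, kurExponent, kurDenom,
    Nat.add_sub_cancel, prod_Icc_one_eq_prod_range _ k, kurLast, pow_add, pow_add,
    Finset.prod_inv_distrib]
  rw [prod_Icc_one_eq_prod_range, Finset.prod_range_succ'] at hprod
  rw [zero_add] at hprod
  calc _ = ((∏ i ∈ Finset.range k, F (i + 1 + 1)) * F 1) * q ^ s.entry (k + 1) *
        ((∏ i ∈ Finset.range k, qPoch q q (s.entry (i + 1) - s.entry (i + 1 + 1)))⁻¹ *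
          (qPoch (q ^ 2) (q ^ 2) (s.entry (k + 1)))⁻¹) := by ring
    _ = _ := by
      rw [hprod, ← mul_inv]
      ring

/-- An ascent makes some s_i - s_{i+1} negative, where the reciprocal q-factorial is zero. -/
theorem kurSummand_eq_zero (s : Fin (k + 1) → ℕ) (hs : ¬Antitone s) : kurSummand q k r I s = 0 := by
  rw [Fin.antitone_iff_succ_le] at hs
  push Not at hs
  obtain ⟨i, hi⟩ := hs
  rw [kurSummand, chainTerm_eq_prod, Finset.prod_eq_zero (Finset.mem_range.2 i.2), zero_mul, mul_zero]
  simp only [chainEntry_tail 0, kurStep]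
  rw [invQFact_of_neg, mul_zero]
  simp only [chainEntry]
  rw [dif_pos (by omega), dif_pos (by omega)]
  have : s ⟨i, by omega⟩ < s ⟨i + 1, by omega⟩ := hi
  omega

theorem hasSum_kurMultisum (hq0 : q ≠ 0) (hq : ‖q‖ < 1) (hk : 1 ≤ k) (hr : r ≤ k)
    (hI : I ⊆ Finset.Icc 1 (k - r)) :
    HasSum (fun s : WeakDecr k => q ^ kurExponent r s * ((∏ i ∈ I, kurFactor q s i) / kurDenom q s))
      (kurProductSide k r I.card q) := by
  obtain ⟨k, rfl⟩ := Nat.exists_eq_add_of_le' hk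
  have h := hasSum_kurSummand hq0 hq hr hI
  rw [← hasSum_subtype_iff_of_support_subset (s := {s | Antitone s}) fun s hs => by
    by_contra hcon
    exact hs (kurSummand_eq_zero s hcon)] at h
  exact h.of_eq (fun s => (kurSummand_eq_prod
    (hI.trans (Finset.Icc_subset_Icc_right (Nat.sub_le _ _))) s).symm) rfl

end Kur

theorem mainTheorem2 (q : ℂ) (hq0 : q ≠ 0) (hq1 : ‖q‖ < 1)
    (k r j : ℕ) (hk : 1 ≤ k) (hjr : j + r ≤ k) :
    HasSum
      (fun s : WeakDecr k =>
        q ^ kurExponent r s *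
          ((q ^ (-∑ i ∈ Finset.Icc 1 j, (s.entry i : ℤ)) *
              ∏ i ∈ Finset.Icc 1 (j - 1), (1 + q ^ (s.entry i + s.entry (i + 1)))) /
            kurDenom q s))
      (kurProductSide k r j q) ∧
    ∀ I : Finset ℕ, I ⊆ insert 1 (Finset.Icc 2 (k - r)) → I.card = j →
      HasSum
        (fun s : WeakDecr k =>
          q ^ kurExponent r s * ((∏ i ∈ I, kurFactor q s i) / kurDenom q s))
        (kurProductSide k r j q) := by
  constructor
  · have h := hasSum_kurMultisum hq0 hq1 hk (by omega : r ≤ k)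
      (Finset.Icc_subset_Icc_right (by omega : j ≤ k - r) : Finset.Icc 1 j ⊆ _)
    rw [Nat.card_Icc, Nat.add_sub_cancel] at h
    refine h.of_eq (fun s => ?_) rfl
    congr 2
    have e1 : ∀ j : ℕ, q ^ (-∑ i ∈ Finset.Icc 1 j, (s.entry i : ℤ)) =
        ∏ i ∈ Finset.Icc 1 j, q ^ (-(s.entry i : ℤ)) := fun j => by
      induction j with
      | zero => simp
      | succ j ih =>
        rw [Finset.sum_Icc_succ_top (by omega), Finset.prod_Icc_succ_top (by omega), ← ih, neg_add,
          zpow_add₀ hq0]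
    rw [e1]
    -- j = 0 is separate because of the truncated j - 1.
    rcases j with _ | j
    · simp
    clear h hjr
    rw [Nat.add_sub_cancel]
    induction j with
    | zero => simp [kurFactor]
    | succ j ih =>
      have e2 := Finset.prod_Icc_succ_top (show 1 ≤ j + 1 by omega)
        fun i => 1 + q ^ (s.entry i + s.entry (i + 1))
      rw [e2, Finset.prod_Icc_succ_top (b := j + 1) (by omega),
        Finset.prod_Icc_succ_top (b := j + 1) (by omega), ← ih, kurFactor, if_neg (by omega),
        Nat.add_sub_cancel]
      ring
  · intro I hI hcard
    rw [← hcard]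
    refine hasSum_kurMultisum hq0 hq1 hk (by omega) fun i hi => ?_
    have h1 := hI hi
    rw [Finset.mem_insert, Finset.mem_Icc] at h1
    -- The index 1 is allowed even when k - r = 0; but a nonempty `I` forces j ≥ 1, hence k - r ≥ 1.
    have h2 : 1 ≤ I.card := Finset.card_pos.2 ⟨i, hi⟩
    rw [Finset.mem_Icc]
    omega
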